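/- Let $T$ be a theory (a set of first-order sentences) over a signature $\Sigma$ of function symbols (constants being the $0$-ary ones) and predicate symbols. Assume that $T$ is universal, i.e. has an axiomatization by universal sentences, and that $T$ allows quantifier elimination, i.e. every first-order formula $\varphi$ over $\Sigma$ is equivalent modulo $T$ to some quantifier-free formula over $\Sigma$. Structures are nonempty, as usual. For a signature $\Sigma'$ disjoint from $\Sigma$, let $T\cup\mathsf{UIF}_{\Sigma'}$ be the theory $T$ regarded over $\Sigma\cup\Sigma'$, the symbols of $\Sigma'$ being uninterpreted. A ground formula is a quantifier-free formula without variables. For ground $\Sigma\cup\Sigma'$-formulas $A,B$, a *general ground interpolant* of $A$ and $B$ is a ground $\Sigma\cup\Sigma'$-formula $I$ such that (i) all constants, function symbols and predicate symbols from $\Sigma'$ that occur in $I$ occur both in $A$ and in $B$ (symbols from $\Sigma$ are unrestricted), and (ii) $A\models_{T\cup\mathsf{UIF}_{\Sigma'}} I$ and $B\wedge I\models_{T\cup\mathsf{UIF}_{\Sigma'}}\bot$. The theory $T$ has *general ground interpolation* if for every signature $\Sigma'$ disjoint from $\Sigma$ and all ground $\Sigma\cup\Sigma'$-formulas $A,B$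 with $A\wedge B\models_{T\cup\mathsf{UIF}_{\Sigma'}}\bot$ there is a general ground interpolant of $A$ and $B$. 1. If $\Sigma$ contains at least one constant symbol, then $T$ has general ground interpolation. 2. Whether or not $\Sigma$ contains a constant symbol, for every signature $\Sigma'$ disjoint from $\Sigma$ and all ground $\Sigma\cup\Sigma'$-formulas $A,B$ such that some constant of $\Sigma'$ occurs both in $A$ and in $B$ and $A\wedge B\models_{T\cup\mathsf{UIF}_{\Sigma'}}\bot$, there is a general ground interpolant of $A$ and $B$. -/

import Mathlib

open FirstOrder

universe u v w u' v'

namespace GroundInterpolation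

open FirstOrder.Language

section Symbols

variable {L : FirstOrder.Language.{u, v}} {α : Type w}

/-- The function symbols (constants being the symbols of arity `0`) that occur in a term. -/
def termFunctions : L.Term α → Set (Σ n, L.Functions n)
  | .var _ => ∅
  | .func f ts => insert ⟨_, f⟩ (⋃ i, termFunctions (ts i))

/-- The function symbols (constants being the symbols of arity `0`) that occur in a formula. -/
def formulaFunctions : ∀ {n : ℕ}, L.BoundedFormula α n → Set (Σ n, L.Functions n)
  | _, .falsum => ∅
  | _, .equal t₁ t₂ => termFunctions t₁ ∪ termFunctions t₂
  | _, .rel _ ts => ⋃ i, termFunctions (ts i)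
  | _, .imp φ ψ => formulaFunctions φ ∪ formulaFunctions ψ
  | _, .all φ => formulaFunctions φ

/-- The predicate symbols (other than equality) that occur in a formula. -/
def formulaRelations : ∀ {n : ℕ}, L.BoundedFormula α n → Set (Σ n, L.Relations n)
  | _, .falsum => ∅
  | _, .equal _ _ => ∅
  | _, .rel R _ => {⟨_, R⟩}
  | _, .imp φ ψ => formulaRelations φ ∪ formulaRelations ψ
  | _, .all φ => formulaRelations φ

end Symbols

section Theories

variable {L : FirstOrder.Language.{u, v}}

/-- `T` is a universal theory: it has an axiomatization by universal sentences, i.e. it is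
logically equivalent to a set `U` of universal sentences. -/
def IsUniversalTheory (T : L.Theory) : Prop :=
  ∃ U : L.Theory, U.IsUniversal ∧ (∀ φ ∈ U, T ⊨ᵇ φ) ∧ (∀ φ ∈ T, U ⊨ᵇ φ)

/-- `T` allows quantifier elimination: every formula is equivalent modulo `T` to a
quantifier-free formula. Variables are indexed by `ℕ`. -/
def AllowsQuantifierElimination (T : L.Theory) : Prop :=
  ∀ φ : L.Formula ℕ, ∃ ψ : L.Formula ℕ, ψ.IsQF ∧ T ⊨ᵇ φ.iff ψ

/-- A ground formula: a quantifier-free formula without variables. -/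
def IsGround (φ : L.Sentence) : Prop := BoundedFormula.IsQF φ

/-- `F ⊨_T G`: every model of `T` in which `F` is true is a model of `G`. -/
def Entails (T : L.Theory) (F G : L.Sentence) : Prop :=
  T ⊨ᵇ BoundedFormula.imp F G

/-- `T ∪ UIF_Σ'`: the theory `T`, regarded as a theory over the disjoint union of its signature `L`
with a signature `L'` of uninterpreted symbols. -/
def withUIF (T : L.Theory) (L' : FirstOrder.Language.{u', v'}) : (L.sum L').Theory :=
  (LHom.sumInl : L →ᴸ L.sum L').onTheory T

/-- `I` is a general ground interpolant of `A` and `B` with respect to `T ∪ UIF_Σ'`: it is ground,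
the symbols of `L'` (constants, functions, predicates) that occur in it occur both in `A` and
in `B`, and it is entailed by `A` and inconsistent with `B`. Symbols of `L` are unrestricted. -/
structure IsGeneralGroundInterpolant (T : L.Theory) (L' : FirstOrder.Language.{u', v'})
    (A B I : (L.sum L').Sentence) : Prop where
  ground : IsGround I
  functions_common : ∀ (n : ℕ) (f : L'.Functions n),
    (⟨n, Sum.inr f⟩ : Σ n, (L.sum L').Functions n) ∈ formulaFunctions I →
      (⟨n, Sum.inr f⟩ : Σ n, (L.sum L').Functions n) ∈ formulaFunctions A ∩ formulaFunctions B
  relations_common : ∀ (n : ℕ) (R : L'.Relations n),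
    (⟨n, Sum.inr R⟩ : Σ n, (L.sum L').Relations n) ∈ formulaRelations I →
      (⟨n, Sum.inr R⟩ : Σ n, (L.sum L').Relations n) ∈ formulaRelations A ∩ formulaRelations B
  entailed : Entails (withUIF T L') A I
  inconsistent : Entails (withUIF T L') (B ⊓ I) ⊥

/-- `T` has general ground interpolation. -/
def HasGeneralGroundInterpolation (T : L.Theory) : Prop :=
  ∀ (L' : FirstOrder.Language.{u', v'}) (A B : (L.sum L').Sentence), IsGround A → IsGround B →
    Entails (withUIF T L') (A ⊓ B) ⊥ →
      ∃ I : (L.sum L').Sentence, IsGeneralGroundInterpolant T L' A B I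

/-- Some constant symbol of `L'` occurs both in `A` and in `B`. -/
def ShareConstant (L' : FirstOrder.Language.{u', v'}) (A B : (L.sum L').Sentence) : Prop :=
  ∃ c : L'.Constants,
    (⟨0, Sum.inr c⟩ : Σ n, (L.sum L').Functions n) ∈ formulaFunctions A ∩ formulaFunctions B

end Theories

end GroundInterpolation

/-!
Let `A` and `B` be ground with no interpolant. By compactness there are models of `A` and of `B`
that satisfy the same ground sentences over the shared symbols, so sending the value of a ground
term over these symbols in one model to its value in the other is a partial isomorphism `ρ`; its
domain is nonempty thanks to the shared constant. The domain of `ρ` is a structure for the base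
signature that embeds in both models. Amalgamating the two models strongly over it identifies
exactly the pairs in `ρ`, so the uninterpreted symbols of both sides can be defined on the amalgam
without conflict, and ground sentences survive: the amalgam is a model of `A` and `B`.

For a universal theory with quantifier elimination, a common substructure of two models is itself
a model, hence an elementary substructure of both. Strong amalgamation is obtained from an
ultrapower of one side indexed by the maps from the other side to the common part. Closedness under
substructures is what makes the amalgam strong: each such map already takes values in the common
part.
-/

namespace GroundInterpolation

open FirstOrder.Language Filter Function

section StrongAmalgamation

variable {L : FirstOrder.Language.{u, v}}

/-- A theory has strong amalgamation if any two of its models with a common nonempty substructure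
embed in a third model so that their images meet exactly in that substructure. The common
substructure need not be a model. -/
def HasStrongAmalgamation (T : L.Theory) : Prop :=
  ∀ (S M N : Type w) [L.Structure S] [L.Structure M] [L.Structure N] [Nonempty S] [M ⊨ T] [N ⊨ T]
    (h : S ↪[L] M) (k : S ↪[L] N), ∃ (D : Type w) (_ : L.Structure D) (f : M ↪[L] D)
    (g : N ↪[L] D), D ⊨ T ∧ ∀ m n, f m = g n ↔ ∃ a, h a = m ∧ k a = n

theorem exists_formula_realize_iff_exists {α γ : Type*} (φ : L.Formula (α ⊕ γ)) :
    ∃ ψ : L.Formula α, ∀ (M : Type w) [L.Structure M] [Nonempty M] (x : α → M),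
      ψ.Realize x ↔ ∃ y : γ → M, φ.Realize (Sum.elim x y) := by
  classical
  let e : φ.freeVarFinset → α ⊕ φ.freeVarFinset := fun c => Sum.elim Sum.inl (fun _ => .inr c) c.1
  refine ⟨Formula.iExs φ.freeVarFinset (φ.restrictFreeVar e), fun M _ _ x =>
    Formula.realize_iExs.trans ⟨fun ⟨z, hz⟩ => ?_, fun ⟨y, hy⟩ => ?_⟩⟩
  · refine ⟨fun c => if hc : .inr c ∈ φ.freeVarFinset then z ⟨_, hc⟩ else Classical.arbitrary M,
      (BoundedFormula.realize_restrictFreeVar _ ?_).1 hz⟩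
    rintro ⟨_ | _, hc⟩ <;> simp [e, hc]
  · refine ⟨fun c => Sum.elim x y c, (BoundedFormula.realize_restrictFreeVar _ ?_).2 hy⟩
    rintro ⟨_ | _, _⟩ <;> simp [e]

theorem exists_realize_sumElim_of_elementaryEmbedding {S N : Type w} [L.Structure S]
    [L.Structure N] [Nonempty S] (k : S ↪ₑ[L] N) {α γ : Type*} {φ : L.Formula (α ⊕ γ)} {x : α → S}
    {y : γ → N} (hφ : φ.Realize (Sum.elim (k ∘ x) y)) :
    ∃ z : γ → S, φ.Realize (Sum.elim x z) := by
  have : Nonempty N := ‹Nonempty S›.map k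
  obtain ⟨ψ, hψ⟩ := exists_formula_realize_iff_exists.{u, v, w} φ
  exact (hψ S x).1 ((k.map_formula ψ x).1 ((hψ N (k ∘ x)).2 ⟨y, hφ⟩))

theorem exists_ultrafilter_realize_sumElim_iff {S N : Type w} [L.Structure S] [L.Structure N]
    [Nonempty S] (k : S ↪ₑ[L] N) :
    ∃ U : Ultrafilter (N → S), ∀ φ : L.Formula (S ⊕ N),
      φ.Realize (Sum.elim k id) ↔ ∀ᶠ r in (U : Filter (N → S)), φ.Realize (Sum.elim id r) := by
  let diagram := {φ : L.Formula (S ⊕ N) // φ.Realize (Sum.elim k id)}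
  let X (φ : diagram) : Set (N → S) := {r | φ.1.Realize (Sum.elim id r)}
  have : Nonempty diagram := ⟨⟨⊤, BoundedFormula.realize_top.2 trivial⟩⟩
  have : NeBot (⨅ φ, 𝓟 (X φ)) := by
    refine iInf_neBot_of_directed (fun φ ψ => ⟨⟨φ.1 ⊓ ψ.1, Formula.realize_inf.2 ⟨φ.2, ψ.2⟩⟩,
      principal_mono.2 fun r hr => (Formula.realize_inf.1 hr).1,
      principal_mono.2 fun r hr => (Formula.realize_inf.1 hr).2⟩) fun φ =>
      principal_neBot_iff.2 (exists_realize_sumElim_of_elementaryEmbedding k φ.2)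
  let U : Ultrafilter (N → S) := Ultrafilter.of (⨅ φ, 𝓟 (X φ))
  have eventually_of_realize (φ : L.Formula (S ⊕ N)) (hφ : φ.Realize (Sum.elim k id)) :
      ∀ᶠ r in (U : Filter (N → S)), φ.Realize (Sum.elim id r) :=
    Ultrafilter.of_le _ (mem_iInf_of_mem ⟨φ, hφ⟩ (mem_principal_self _))
  refine ⟨U, fun φ => ⟨eventually_of_realize φ, fun h => by_contra fun hφ => ?_⟩⟩
  obtain ⟨r, hr, hr'⟩ := (h.and (eventually_of_realize φ.not hφ)).exists
  exact hr' hr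

/-- The diagonal embedding of a structure in its ultrapower. -/
def ultrapowerDiagonal (L : FirstOrder.Language.{u, v}) {ι M : Type*} [L.Structure M] [Nonempty M]
    (U : Ultrafilter ι) : M ↪ₑ[L] (U : Filter ι).Product fun _ => M where
  toFun m := ((fun _ => m : ι → M) : (U : Filter ι).Product fun _ => M)
  map_formula' _ φ x := (Ultraproduct.realize_formula_cast φ fun i _ => x i).trans eventually_const

theorem exists_strong_elementary_amalgam {S M N : Type w} [L.Structure S] [L.Structure M]
    [L.Structure N] [Nonempty S] (h : S ↪ₑ[L] M) (k : S ↪ₑ[L] N) :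
    ∃ (D : Type w) (_ : L.Structure D) (f : M ↪ₑ[L] D) (g : N ↪ₑ[L] D),
      ∀ m n, f m = g n ↔ ∃ a, h a = m ∧ k a = n := by
  have : Nonempty M := ‹Nonempty S›.map h
  obtain ⟨U, hU⟩ := exists_ultrafilter_realize_sumElim_iff k
  let D := (U : Filter (N → S)).Product fun _ => M
  let f : M ↪ₑ[L] D := ultrapowerDiagonal L U
  let g : N ↪ₑ[L] D :=
    { toFun n := ((fun r => h (r n) : (N → S) → M) : D)
      map_formula' j φ x := calc
        _ ↔ ∀ᶠ r in (U : Filter (N → S)), φ.Realize (h ∘ r ∘ x) :=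
          Ultraproduct.realize_formula_cast φ fun i (r : N → S) => h (r (x i))
        _ ↔ ∀ᶠ r in (U : Filter (N → S)), φ.Realize (r ∘ x) :=
          eventually_congr (.of_forall fun r => h.map_formula φ (r ∘ x))
        _ ↔ ∀ᶠ r in (U : Filter (N → S)), (φ.relabel (Sum.inr ∘ x)).Realize (Sum.elim id r) := by
          simp only [Formula.realize_relabel, ← comp_assoc, Sum.elim_comp_inr]
        _ ↔ φ.Realize x := by
          rw [← hU, Formula.realize_relabel, ← comp_assoc, Sum.elim_comp_inr, id_comp] }
  have hfg (a : S) : f (h a) = g (k a) := by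
    have hfix := (hU (Term.equal (.var (.inl a)) (.var (.inr (k a))))).1 (by simp)
    refine Quotient.sound' (hfix.mono fun r hr => congrArg h ?_)
    simpa using hr
  refine ⟨D, inferInstance, f, g, fun m n => ⟨fun hmn => ?_, ?_⟩⟩
  · obtain ⟨r, hr⟩ := (show ∀ᶠ r in (U : Filter (N → S)), m = h (r n) from
      Quotient.exact' hmn).exists
    exact ⟨r n, hr.symm, g.injective (by rw [← hfg, ← hr, hmn])⟩
  · rintro ⟨a, rfl, rfl⟩
    exact hfg a

/-- An embedding between models of a theory with quantifier elimination, as an elementary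
embedding. -/
def AllowsQuantifierElimination.toElementaryEmbedding {T : L.Theory}
    (hT : AllowsQuantifierElimination T) {M N : Type*} [L.Structure M] [L.Structure N] [Nonempty M]
    [M ⊨ T] [N ⊨ T] (f : M ↪[L] N) : M ↪ₑ[L] N where
  toFun := f
  map_formula' n φ x := by
    have : Nonempty N := ‹Nonempty M›.map f
    obtain ⟨ψ, hψ, hφψ⟩ := hT (φ.relabel Fin.val)
    obtain ⟨y, rfl⟩ : ∃ y : ℕ → M, y ∘ Fin.val = x :=
      ⟨extend Fin.val x fun _ => Classical.arbitrary M, extend_comp Fin.val_injective _ _⟩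
    have hM : φ.Realize (y ∘ Fin.val) ↔ ψ.Realize y :=
      Formula.realize_relabel.symm.trans (Formula.realize_iff.1 (hφψ.realize_formula M))
    have hN : φ.Realize ((f ∘ y) ∘ Fin.val) ↔ ψ.Realize (f ∘ y) :=
      Formula.realize_relabel.symm.trans (Formula.realize_iff.1 (hφψ.realize_formula N))
    rw [hM, ← comp_assoc, hN, Formula.Realize, Formula.Realize, ← hψ.realize_embedding f,
      Subsingleton.elim (f ∘ default) default]

theorem IsUniversalTheory.models_of_embedding {T : L.Theory} (hT : IsUniversalTheory T)
    {S M : Type*} [L.Structure S] [L.Structure M] [Nonempty S] [M ⊨ T] (h : S ↪[L] M) : S ⊨ T := by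
  have : Nonempty M := ‹Nonempty S›.map h
  obtain ⟨V, hV, hTV, hVT⟩ := hT
  have : M ⊨ V := V.model_iff.2 fun φ hφ => (hTV φ hφ).realize_sentence M
  have : S ⊨ V := Theory.IsUniversal.models_of_embedding h
  exact T.model_iff.2 fun φ hφ => (hVT φ hφ).realize_sentence S

theorem AllowsQuantifierElimination.hasStrongAmalgamation {T : L.Theory}
    (hQE : AllowsQuantifierElimination T) (hU : IsUniversalTheory T) :
    HasStrongAmalgamation.{u, v, w} T := by
  intro S M N _ _ _ _ _ _ h k
  have : S ⊨ T := hU.models_of_embedding h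
  obtain ⟨D, _, f, g, hfg⟩ := exists_strong_elementary_amalgam
    (hQE.toElementaryEmbedding h) (hQE.toElementaryEmbedding k)
  exact ⟨D, inferInstance, f.toEmbedding, g.toEmbedding, (f.theory_model_iff T).1 ‹_›, hfg⟩

end StrongAmalgamation

section Separation

variable {K : FirstOrder.Language.{u, v}} {T : K.Theory} {𝒮 : Set K.Sentence}

theorem exists_mem_realize_iff_forall (hbot : ⊥ ∈ 𝒮)
    (himp : ∀ φ ∈ 𝒮, ∀ ψ ∈ 𝒮, BoundedFormula.imp φ ψ ∈ 𝒮) (Γ : Finset K.Sentence)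
    (hΓ : ∀ φ ∈ Γ, φ ∈ 𝒮) :
    ∃ ψ ∈ 𝒮, ∀ (M : Type w) [K.Structure M], M ⊨ ψ ↔ ∀ φ ∈ Γ, M ⊨ φ := by
  classical
  induction Γ using Finset.induction_on with
  | empty => exact ⟨_, himp _ hbot _ hbot, fun M _ => by simp [Sentence.Realize, Formula.Realize]⟩
  | insert φ Γ _ ih =>
    rw [Finset.forall_mem_insert] at hΓ
    obtain ⟨ψ, hψ, h⟩ := ih hΓ.2
    refine ⟨φ ⊓ ψ, himp _ (himp _ hΓ.1 _ (himp _ hψ _ hbot)) _ hbot, fun M _ => ?_⟩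
    rw [Finset.forall_mem_insert, ← h M]
    exact Formula.realize_inf

theorem exists_model_of_forall_not_entails (hbot : ⊥ ∈ 𝒮)
    (himp : ∀ φ ∈ 𝒮, ∀ ψ ∈ 𝒮, BoundedFormula.imp φ ψ ∈ 𝒮) {Γ : K.Theory} (hΓ : Γ ⊆ 𝒮)
    {B : K.Sentence} (h : ∀ ψ ∈ 𝒮, Γ ⊨ᵇ ψ → ¬ Entails T ψ B.not) :
    ∃ M : Theory.ModelType.{u, v, max u v} T, M ⊨ Γ ∧ M ⊨ B := by
  classical
  suffices hB : ¬ T ∪ Γ ⊨ᵇ B.not by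
    rw [Theory.models_sentence_iff, not_forall] at hB
    obtain ⟨M, hM⟩ := hB
    rw [Sentence.realize_not, not_not] at hM
    exact ⟨M.subtheoryModel Set.subset_union_left,
      (M.subtheoryModel Set.subset_union_right).is_model, hM⟩
  intro hB
  obtain ⟨Δ, hΔ, hΔB⟩ := Theory.models_iff_finset_models.1 hB
  obtain ⟨ψ, hψ, hψΔ⟩ := exists_mem_realize_iff_forall hbot himp (Δ.filter (· ∈ Γ))
    fun φ hφ => hΓ (Finset.mem_filter.1 hφ).2
  refine h ψ hψ (Theory.models_sentence_iff.2 fun M => (hψΔ M).2 fun φ hφ =>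
    M.is_model.realize_of_mem φ (Finset.mem_filter.1 hφ).2)
    (Theory.models_sentence_iff.2 fun M => ?_)
  intro hMψ
  have : M ⊨ (Δ : K.Theory) := Theory.model_iff _ |>.2 fun φ hφ => (hΔ hφ).elim
    (Theory.realize_sentence_of_mem T) fun hφΓ => (hψΔ M).1 hMψ φ (Finset.mem_filter.2 ⟨hφ, hφΓ⟩)
  exact hΔB.realize_sentence M

theorem exists_models_realize_iff_of_not_separated (hbot : ⊥ ∈ 𝒮)
    (himp : ∀ φ ∈ 𝒮, ∀ ψ ∈ 𝒮, BoundedFormula.imp φ ψ ∈ 𝒮) {A B : K.Sentence}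
    (h : ∀ φ ∈ 𝒮, Entails T A φ → ¬ Entails T (B ⊓ φ) ⊥) :
    ∃ M N : Theory.ModelType.{u, v, max u v} T, M ⊨ A ∧ N ⊨ B ∧ ∀ φ ∈ 𝒮, M ⊨ φ ↔ N ⊨ φ := by
  obtain ⟨N, hNA, hNB⟩ : ∃ N : T.ModelType, N ⊨ {φ ∈ 𝒮 | Entails T A φ} ∧ N ⊨ B := by
    refine exists_model_of_forall_not_entails hbot himp (fun φ hφ => hφ.1) fun ψ hψ hAψ hψB => ?_
    refine h ψ hψ (Theory.models_sentence_iff.2 fun M hMA => ?_)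
      (Theory.models_sentence_iff.2 fun M hM => ?_)
    · have : M ⊨ {φ ∈ 𝒮 | Entails T A φ} :=
        (Theory.model_iff _).2 fun φ hφ => hφ.2.realize_sentence M hMA
      exact hAψ.realize_sentence M
    · obtain ⟨hMB, hMψ⟩ := Formula.realize_inf.1 hM
      exact hψB.realize_sentence M hMψ hMB
  obtain ⟨M, hMN, hMA⟩ : ∃ M : T.ModelType, M ⊨ {φ ∈ 𝒮 | N ⊨ φ} ∧ M ⊨ A := by
    refine exists_model_of_forall_not_entails hbot himp (fun φ hφ => hφ.1) fun ψ hψ hNψ hψA => ?_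
    have hAψ : Entails T A ψ.not := Theory.models_sentence_iff.2 fun M hMA hMψ =>
      hψA.realize_sentence M hMψ hMA
    have : N ⊨ {φ ∈ 𝒮 | N ⊨ φ} := (Theory.model_iff _).2 fun φ hφ => hφ.2
    exact hNA.realize_of_mem ψ.not ⟨himp _ hψ _ hbot, hAψ⟩ (hNψ.realize_sentence N)
  refine ⟨M, N, hMA, hNB, fun φ hφ => ⟨fun hM => by_contra fun hN => ?_, fun hN => ?_⟩⟩
  · exact hMN.realize_of_mem φ.not ⟨himp _ hφ _ hbot, hN⟩ hM
  · exact hMN.realize_of_mem φ ⟨hφ, hN⟩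

end Separation

section PartialIsomorphism

variable {K : FirstOrder.Language.{u, v}} {F : Set (Σ n, K.Functions n)}
  {R : Set (Σ n, K.Relations n)} {M N : Type*} [K.Structure M] [K.Structure N]
  {ρ : M → N → Prop}

/-- `ρ` is the graph of an isomorphism between a subset of `M` and a subset of `N`, both closed
under the functions in `F`, with respect to the function symbols in `F` and the predicate symbols
in `R`. -/
structure IsPartialIsomorphism (F : Set (Σ n, K.Functions n)) (R : Set (Σ n, K.Relations n))
    (ρ : M → N → Prop) : Prop where
  eq_iff : ∀ {a a' : M} {b b' : N}, ρ a b → ρ a' b' → (a = a' ↔ b = b')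
  funMap : ∀ {n : ℕ} {f : K.Functions n}, ⟨n, f⟩ ∈ F → ∀ {x : Fin n → M} {y : Fin n → N},
    (∀ i, ρ (x i) (y i)) → ρ (Structure.funMap f x) (Structure.funMap f y)
  relMap_iff : ∀ {n : ℕ} {r : K.Relations n}, ⟨n, r⟩ ∈ R → ∀ {x : Fin n → M} {y : Fin n → N},
    (∀ i, ρ (x i) (y i)) → (Structure.RelMap r x ↔ Structure.RelMap r y)

theorem isPartialIsomorphism_graph {f : M → N} (hf : Injective f)
    (hF : ∀ {n : ℕ} {s : K.Functions n}, ⟨n, s⟩ ∈ F → ∀ x : Fin n → M,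
      f (Structure.funMap s x) = Structure.funMap s (f ∘ x))
    (hR : ∀ {n : ℕ} {r : K.Relations n}, ⟨n, r⟩ ∈ R → ∀ x : Fin n → M,
      Structure.RelMap r (f ∘ x) ↔ Structure.RelMap r x) :
    IsPartialIsomorphism F R (f · = ·) where
  eq_iff := by
    rintro a a' _ _ rfl rfl
    exact hf.eq_iff.symm
  funMap hs x y hxy := by
    obtain rfl : f ∘ x = y := funext hxy
    exact hF hs x
  relMap_iff hr x y hxy := by
    obtain rfl : f ∘ x = y := funext hxy
    exact (hR hr x).symm

theorem isPartialIsomorphism_graph_embedding (f : M ↪[K] N) :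
    IsPartialIsomorphism F R (f · = ·) :=
  isPartialIsomorphism_graph f.injective (fun _ x => f.map_fun _ x) fun _ x => f.map_rel _ x

namespace IsPartialIsomorphism

theorem realize_term (hρ : IsPartialIsomorphism F R ρ) {α : Type*} {t : K.Term α}
    (ht : termFunctions t ⊆ F) {x : α → M} {y : α → N} (hxy : ∀ i, ρ (x i) (y i)) :
    ρ (t.realize x) (t.realize y) := by
  induction t with
  | var i => exact hxy i
  | func f ts ih =>
    rw [termFunctions, Set.insert_subset_iff, Set.iUnion_subset_iff] at ht
    exact hρ.funMap ht.1 fun i => ih i (ht.2 i)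

theorem realize_isQF_iff (hρ : IsPartialIsomorphism F R ρ) {α : Type*} {n : ℕ}
    {φ : K.BoundedFormula α n} (hφ : φ.IsQF) (hF : formulaFunctions φ ⊆ F)
    (hR : formulaRelations φ ⊆ R) {x : α → M} {y : α → N} {x' : Fin n → M} {y' : Fin n → N}
    (hxy : ∀ i, ρ (Sum.elim x x' i) (Sum.elim y y' i)) :
    φ.Realize x x' ↔ φ.Realize y y' := by
  induction hφ with
  | falsum => rfl
  | of_isAtomic h =>
    cases h with
    | equal t₁ t₂ =>
      have hF' := Set.union_subset_iff.1 hF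
      exact hρ.eq_iff (hρ.realize_term hF'.1 hxy) (hρ.realize_term hF'.2 hxy)
    | rel r ts =>
      have hF' := Set.iUnion_subset_iff.1 hF
      exact hρ.relMap_iff (hR rfl) fun i => hρ.realize_term (hF' i) hxy
  | imp _ _ ih₁ ih₂ =>
    have hF' := Set.union_subset_iff.1 hF
    have hR' := Set.union_subset_iff.1 hR
    exact imp_congr (ih₁ hF'.1 hR'.1) (ih₂ hF'.2 hR'.2)

theorem realize_sentence_iff {φ : K.Sentence}
    (hρ : IsPartialIsomorphism (formulaFunctions φ) (formulaRelations φ) ρ) (hφ : IsGround φ) :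
    M ⊨ φ ↔ N ⊨ φ :=
  hρ.realize_isQF_iff hφ subset_rfl subset_rfl isEmptyElim

theorem reduct (hρ : IsPartialIsomorphism F R ρ) {L : FirstOrder.Language.{u', v'}} (ι : L →ᴸ K)
    [L.Structure M] [L.Structure N] [ι.IsExpansionOn M] [ι.IsExpansionOn N]
    {F' : Set (Σ n, L.Functions n)} {R' : Set (Σ n, L.Relations n)}
    (hF : ∀ {n : ℕ} {f : L.Functions n}, ⟨n, f⟩ ∈ F' → ⟨n, ι.onFunction f⟩ ∈ F)
    (hR : ∀ {n : ℕ} {r : L.Relations n}, ⟨n, r⟩ ∈ R' → ⟨n, ι.onRelation r⟩ ∈ R) :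
    IsPartialIsomorphism F' R' ρ where
  eq_iff := hρ.eq_iff
  funMap hf x y hxy := by
    simpa only [ι.map_onFunction] using hρ.funMap (hF hf) hxy
  relMap_iff hr x y hxy := by
    simpa only [ι.map_onRelation] using hρ.relMap_iff (hR hr) hxy

end IsPartialIsomorphism

end PartialIsomorphism

section GroundSentences

variable {K : FirstOrder.Language.{u, v}}

/-- The ground sentences whose symbols belong to `F` and `R`. -/
def groundSentences (F : Set (Σ n, K.Functions n)) (R : Set (Σ n, K.Relations n)) :
    Set K.Sentence :=
  {φ | IsGround φ ∧ formulaFunctions φ ⊆ F ∧ formulaRelations φ ⊆ R}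

variable {F : Set (Σ n, K.Functions n)} {R : Set (Σ n, K.Relations n)}

theorem bot_mem_groundSentences : ⊥ ∈ groundSentences F R :=
  ⟨BoundedFormula.isQF_bot, Set.empty_subset _, Set.empty_subset _⟩

theorem imp_mem_groundSentences (φ : K.Sentence) (hφ : φ ∈ groundSentences F R) (ψ : K.Sentence)
    (hψ : ψ ∈ groundSentences F R) : BoundedFormula.imp φ ψ ∈ groundSentences F R :=
  ⟨hφ.1.imp hψ.1, Set.union_subset hφ.2.1 hψ.2.1, Set.union_subset hφ.2.2 hψ.2.2⟩

variable {M N : Type*} [K.Structure M] [K.Structure N]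

/-- Some ground term over the function symbols in `F` has the value `a` in `M` and `b` in `N`.
Ground terms are the terms that occur in sentences, hence their type of variables. -/
def AreGroundValues (F : Set (Σ n, K.Functions n)) (a : M) (b : N) : Prop :=
  ∃ t : K.Term (Empty ⊕ Fin 0), termFunctions t ⊆ F ∧
    t.realize (Sum.elim default default) = a ∧ t.realize (Sum.elim default default) = b

theorem AreGroundValues.funMap {n : ℕ} {f : K.Functions n} (hf : ⟨n, f⟩ ∈ F) {x : Fin n → M}
    {y : Fin n → N} (hxy : ∀ i, AreGroundValues F (x i) (y i)) :
    AreGroundValues F (Structure.funMap f x) (Structure.funMap f y) := by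
  choose t ht hx hy using hxy
  refine ⟨.func f t, Set.insert_subset hf (Set.iUnion_subset ht), ?_, ?_⟩
  · rw [Term.realize_func, funext hx]
  · rw [Term.realize_func, funext hy]

theorem isPartialIsomorphism_areGroundValues
    (h : ∀ φ ∈ groundSentences F R, M ⊨ φ ↔ N ⊨ φ) :
    IsPartialIsomorphism F R (AreGroundValues F : M → N → Prop) where
  eq_iff := by
    rintro _ _ _ _ ⟨t, ht, rfl, rfl⟩ ⟨t', ht', rfl, rfl⟩
    exact h (t.bdEqual t') ⟨(BoundedFormula.IsAtomic.equal _ _).isQF, Set.union_subset ht ht',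
      Set.empty_subset _⟩
  funMap hf _ _ hxy := AreGroundValues.funMap hf hxy
  relMap_iff {n r} hr x y hxy := by
    choose t ht hx hy using hxy
    obtain rfl := funext hx
    obtain rfl := funext hy
    exact h (r.boundedFormula t) ⟨(BoundedFormula.IsAtomic.rel _ _).isQF,
      Set.iUnion_subset ht, Set.singleton_subset_iff.2 hr⟩

end GroundSentences

section Gluing

theorem exists_common_extension {X Y Z C : Type*} [Nonempty C] {i : X → Z} {j : Y → Z}
    (hi : Injective i) (hj : Injective j) {p : X → C} {q : Y → C} {P Q : Prop}
    (h : P → Q → ∀ x y, i x = j y → p x = q y) :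
    ∃ e : Z → C, (P → ∀ x, e (i x) = p x) ∧ (Q → ∀ y, e (j y) = q y) := by
  by_cases hP : P
  · refine ⟨extend i p (extend j q fun _ => Classical.arbitrary C),
      fun _ => hi.extend_apply _ _, fun hQ y => ?_⟩
    by_cases hy : ∃ x, i x = j y
    · obtain ⟨x, hx⟩ := hy
      rw [← hx, hi.extend_apply, h hP hQ x y hx]
    · rw [extend_apply' _ _ _ hy, hj.extend_apply]
  · exact ⟨extend j q fun _ => Classical.arbitrary C, fun hP' => absurd hP' hP,
      fun _ => hj.extend_apply _ _⟩

theorem exists_structure_of_isPartialIsomorphism {L : FirstOrder.Language.{u, v}} {M N D : Type*}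
    [L.Structure M] [L.Structure N] [Nonempty D] {f : M → D} {g : N → D} (hf : Injective f)
    (hg : Injective g) {FM FN : Set (Σ n, L.Functions n)} {RM RN : Set (Σ n, L.Relations n)}
    (h : IsPartialIsomorphism (FM ∩ FN) (RM ∩ RN) fun m n => f m = g n) :
    ∃ _ : L.Structure D,
      IsPartialIsomorphism FM RM (f · = ·) ∧ IsPartialIsomorphism FN RN (g · = ·) := by
  have exists_funMap (n : ℕ) (s : L.Functions n) : ∃ e : (Fin n → D) → D,
      (⟨n, s⟩ ∈ FM → ∀ x, e (f ∘ x) = f (Structure.funMap s x)) ∧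
        (⟨n, s⟩ ∈ FN → ∀ y, e (g ∘ y) = g (Structure.funMap s y)) :=
    exists_common_extension hf.comp_left hg.comp_left fun hM hN _ _ hxy =>
      h.funMap ⟨hM, hN⟩ (congrFun hxy)
  have exists_relMap (n : ℕ) (r : L.Relations n) : ∃ e : (Fin n → D) → Prop,
      (⟨n, r⟩ ∈ RM → ∀ x, e (f ∘ x) = Structure.RelMap r x) ∧
        (⟨n, r⟩ ∈ RN → ∀ y, e (g ∘ y) = Structure.RelMap r y) :=
    exists_common_extension hf.comp_left hg.comp_left fun hM hN _ _ hxy =>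
      propext (h.relMap_iff ⟨hM, hN⟩ (congrFun hxy))
  choose funMap funMap_left funMap_right using exists_funMap
  choose relMap relMap_left relMap_right using exists_relMap
  let _ : L.Structure D := ⟨fun {n} => funMap n, fun {n} => relMap n⟩
  exact ⟨inferInstance,
    isPartialIsomorphism_graph hf (fun hs x => (funMap_left _ _ hs x).symm)
      fun hr x => iff_of_eq (relMap_left _ _ hr x),
    isPartialIsomorphism_graph hg (fun hs y => (funMap_right _ _ hs y).symm)
      fun hr y => iff_of_eq (relMap_right _ _ hr y)⟩

theorem HasStrongAmalgamation.exists_amalgam_of_isPartialIsomorphism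
    {L : FirstOrder.Language.{u, v}} {T : L.Theory} (hT : HasStrongAmalgamation.{u, v, w} T)
    {M N : Type w} [L.Structure M] [L.Structure N] [M ⊨ T] [N ⊨ T] {ρ : M → N → Prop}
    (hρ : IsPartialIsomorphism (K := L) Set.univ Set.univ ρ) (hne : ∃ a b, ρ a b) :
    ∃ (D : Type w) (_ : L.Structure D) (f : M ↪[L] D) (g : N ↪[L] D),
      D ⊨ T ∧ ∀ m n, f m = g n ↔ ρ m n := by
  let S := {p : M × N // ρ p.1 p.2}
  let _ : L.Structure S :=
    { funMap s z := ⟨(Structure.funMap s fun i => (z i).1.1, Structure.funMap s fun i => (z i).1.2),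
        hρ.funMap trivial fun i => (z i).2⟩
      RelMap r z := Structure.RelMap r fun i => (z i).1.1 }
  have : Nonempty S := let ⟨a, b, hab⟩ := hne; ⟨⟨(a, b), hab⟩⟩
  let h : S ↪[L] M :=
    { toFun p := p.1.1
      inj' p q hpq := Subtype.ext (Prod.ext hpq ((hρ.eq_iff p.2 q.2).1 hpq)) }
  let k : S ↪[L] N :=
    { toFun p := p.1.2
      inj' p q hpq := Subtype.ext (Prod.ext ((hρ.eq_iff p.2 q.2).2 hpq) hpq)
      map_rel' _ z := (hρ.relMap_iff trivial fun i => (z i).2).symm }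
  obtain ⟨D, _, f, g, hDT, hfg⟩ := hT S M N h k
  refine ⟨D, inferInstance, f, g, hDT, fun m n => (hfg m n).trans ⟨?_, fun hmn => ?_⟩⟩
  · rintro ⟨p, rfl, rfl⟩
    exact p.2
  · exact ⟨⟨(m, n), hmn⟩, rfl, rfl⟩

end Gluing

section UninterpretedSymbols

variable {L : FirstOrder.Language.{u, v}} {L' : FirstOrder.Language.{u', v'}}

/-- The uninterpreted function symbols, those of `L'`, that occur in `φ`. -/
def uninterpretedFunctions (φ : (L.sum L').Sentence) : Set (Σ n, L'.Functions n) :=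
  {s | ⟨s.1, .inr s.2⟩ ∈ formulaFunctions φ}

/-- The uninterpreted predicate symbols, those of `L'`, that occur in `φ`. -/
def uninterpretedRelations (φ : (L.sum L').Sentence) : Set (Σ n, L'.Relations n) :=
  {s | ⟨s.1, .inr s.2⟩ ∈ formulaRelations φ}

/-- The function symbols allowed in an interpolant of `A` and `B`: all those of `L`, and those of
`L'` that occur in both formulas. -/
def sharedFunctions (A B : (L.sum L').Sentence) : Set (Σ n, (L.sum L').Functions n) :=
  {s | ∀ f, s.2 = .inr f → ⟨s.1, f⟩ ∈ uninterpretedFunctions A ∩ uninterpretedFunctions B}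

/-- The predicate symbols allowed in an interpolant of `A` and `B`: all those of `L`, and those of
`L'` that occur in both formulas. -/
def sharedRelations (A B : (L.sum L').Sentence) : Set (Σ n, (L.sum L').Relations n) :=
  {s | ∀ r, s.2 = .inr r → ⟨s.1, r⟩ ∈ uninterpretedRelations A ∩ uninterpretedRelations B}

theorem inl_mem_sharedFunctions (A B : (L.sum L').Sentence) {n : ℕ} (f : L.Functions n) :
    ⟨n, .inl f⟩ ∈ sharedFunctions A B :=
  fun _ h => nomatch h

theorem inl_mem_sharedRelations (A B : (L.sum L').Sentence) {n : ℕ} (r : L.Relations n) :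
    ⟨n, .inl r⟩ ∈ sharedRelations A B :=
  fun _ h => nomatch h

theorem inr_mem_sharedFunctions {A B : (L.sum L').Sentence} {n : ℕ} {f : L'.Functions n} :
    ⟨n, .inr f⟩ ∈ sharedFunctions A B ↔
      ⟨n, f⟩ ∈ uninterpretedFunctions A ∩ uninterpretedFunctions B :=
  ⟨fun h => h f rfl, fun h _ hf => Sum.inr_injective hf ▸ h⟩

theorem inr_mem_sharedRelations {A B : (L.sum L').Sentence} {n : ℕ} {r : L'.Relations n} :
    ⟨n, .inr r⟩ ∈ sharedRelations A B ↔
      ⟨n, r⟩ ∈ uninterpretedRelations A ∩ uninterpretedRelations B :=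
  ⟨fun h => h r rfl, fun h _ hr => Sum.inr_injective hr ▸ h⟩

theorem IsPartialIsomorphism.sum {M N : Type*} [L.Structure M] [L.Structure N] [L'.Structure M]
    [L'.Structure N] [(L.sum L').Structure M] [(L.sum L').Structure N]
    [(LHom.sumInl : L →ᴸ L.sum L').IsExpansionOn M] [(LHom.sumInl : L →ᴸ L.sum L').IsExpansionOn N]
    [(LHom.sumInr : L' →ᴸ L.sum L').IsExpansionOn M]
    [(LHom.sumInr : L' →ᴸ L.sum L').IsExpansionOn N]
    {φ : (L.sum L').Sentence} {ρ : M → N → Prop}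
    (h : IsPartialIsomorphism (K := L) Set.univ Set.univ ρ)
    (h' : IsPartialIsomorphism (uninterpretedFunctions φ) (uninterpretedRelations φ) ρ) :
    IsPartialIsomorphism (formulaFunctions φ) (formulaRelations φ) ρ where
  eq_iff := h.eq_iff
  funMap {n s} hs x y hxy := by
    cases s with
    | inl s => simpa only [LHom.funMap_sumInl] using h.funMap (f := s) trivial hxy
    | inr s => simpa only [LHom.funMap_sumInr] using h'.funMap (f := s) hs hxy
  relMap_iff {n r} hr x y hxy := by
    cases r with
    | inl r => calc
        _ ↔ Structure.RelMap r x := (LHom.map_onRelation LHom.sumInl r x).to_iff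
        _ ↔ Structure.RelMap r y := h.relMap_iff trivial hxy
        _ ↔ _ := (LHom.map_onRelation LHom.sumInl r y).symm.to_iff
    | inr r => calc
        _ ↔ Structure.RelMap r x := (LHom.map_onRelation LHom.sumInr r x).to_iff
        _ ↔ Structure.RelMap r y := h'.relMap_iff hr hxy
        _ ↔ _ := (LHom.map_onRelation LHom.sumInr r y).symm.to_iff

theorem HasStrongAmalgamation.exists_model_of_isPartialIsomorphism {T : L.Theory}
    (hT : HasStrongAmalgamation.{u, v, w} T) {A B : (L.sum L').Sentence} (hA : IsGround A)
    (hB : IsGround B) {M N : Type w} [(L.sum L').Structure M] [(L.sum L').Structure N]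
    (hM : M ⊨ withUIF T L') (hN : N ⊨ withUIF T L') (hMA : M ⊨ A) (hNB : N ⊨ B)
    {ρ : M → N → Prop} (hρ : IsPartialIsomorphism (sharedFunctions A B) (sharedRelations A B) ρ)
    (hne : ∃ a b, ρ a b) :
    ∃ (D : Type w) (_ : (L.sum L').Structure D),
      Nonempty D ∧ D ⊨ withUIF T L' ∧ D ⊨ A ∧ D ⊨ B := by
  let _ : L.Structure M := (LHom.sumInl : L →ᴸ L.sum L').reduct M
  let _ : L.Structure N := (LHom.sumInl : L →ᴸ L.sum L').reduct N
  let _ : L'.Structure M := (LHom.sumInr : L' →ᴸ L.sum L').reduct M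
  let _ : L'.Structure N := (LHom.sumInr : L' →ᴸ L.sum L').reduct N
  have : M ⊨ T := (LHom.onTheory_model LHom.sumInl T).1 hM
  have : N ⊨ T := (LHom.onTheory_model LHom.sumInl T).1 hN
  obtain ⟨D, _, f, g, hDT, hfg⟩ := hT.exists_amalgam_of_isPartialIsomorphism
    (hρ.reduct LHom.sumInl (fun _ => inl_mem_sharedFunctions A B _)
      fun _ => inl_mem_sharedRelations A B _) hne
  obtain ⟨a, -⟩ := hne
  have : Nonempty D := ⟨f a⟩
  obtain rfl : (fun m n => f m = g n) = ρ := funext₂ fun m n => propext (hfg m n)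
  obtain ⟨_, hf, hg⟩ := exists_structure_of_isPartialIsomorphism f.injective g.injective <|
    hρ.reduct LHom.sumInr inr_mem_sharedFunctions.2 inr_mem_sharedRelations.2
  exact ⟨D, inferInstance, inferInstance, (LHom.onTheory_model LHom.sumInl T).2 hDT,
    (((isPartialIsomorphism_graph_embedding f).sum hf).realize_sentence_iff hA).1 hMA,
    (((isPartialIsomorphism_graph_embedding g).sum hg).realize_sentence_iff hB).1 hNB⟩

theorem isGeneralGroundInterpolant_of_mem_groundSentences {T : L.Theory}
    {A B I : (L.sum L').Sentence}
    (hI : I ∈ groundSentences (sharedFunctions A B) (sharedRelations A B))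
    (hAI : Entails (withUIF T L') A I) (hBI : Entails (withUIF T L') (B ⊓ I) ⊥) :
    IsGeneralGroundInterpolant T L' A B I where
  ground := hI.1
  functions_common _ _ hf := inr_mem_sharedFunctions.1 (hI.2.1 hf)
  relations_common _ _ hr := inr_mem_sharedRelations.1 (hI.2.2 hr)
  entailed := hAI
  inconsistent := hBI

end UninterpretedSymbols

end GroundInterpolation

open GroundInterpolation in
theorem mainTheorem12_general {L : FirstOrder.Language.{u, v}} {T : L.Theory}
    (hT : HasStrongAmalgamation.{u, v, max u v u' v'} T) {L' : FirstOrder.Language.{u', v'}}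
    {A B : (L.sum L').Sentence} (hA : IsGround A) (hB : IsGround B) {c : (L.sum L').Constants}
    (hc : ⟨0, c⟩ ∈ sharedFunctions A B) (hAB : Entails (withUIF T L') (A ⊓ B) ⊥) :
    ∃ I : (L.sum L').Sentence, IsGeneralGroundInterpolant T L' A B I := by
  by_contra hI
  obtain ⟨M, N, hMA, hNB, hMN⟩ := exists_models_realize_iff_of_not_separated
    bot_mem_groundSentences imp_mem_groundSentences fun I hI' hAI hBI =>
      hI ⟨I, isGeneralGroundInterpolant_of_mem_groundSentences hI' hAI hBI⟩
  obtain ⟨D, _, _, _, hDA, hDB⟩ := hT.exists_model_of_isPartialIsomorphism hA hB M.is_model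
    N.is_model hMA hNB (isPartialIsomorphism_areGroundValues hMN)
    ⟨_, _, AreGroundValues.funMap hc (x := isEmptyElim) (y := isEmptyElim) isEmptyElim⟩
  exact hAB.realize_sentence D (FirstOrder.Language.Formula.realize_inf.2 ⟨hDA, hDB⟩)

theorem mainTheorem12 {L : FirstOrder.Language.{u, v}} (T : L.Theory)
    (hU : GroundInterpolation.IsUniversalTheory T)
    (hQE : GroundInterpolation.AllowsQuantifierElimination T) :
    (Nonempty L.Constants →
      GroundInterpolation.HasGeneralGroundInterpolation.{u, v, u', v'} T) ∧
    ∀ (L' : FirstOrder.Language.{u', v'}) (A B : (L.sum L').Sentence),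
      GroundInterpolation.IsGround A → GroundInterpolation.IsGround B →
      GroundInterpolation.ShareConstant L' A B →
      GroundInterpolation.Entails (GroundInterpolation.withUIF T L') (A ⊓ B) ⊥ →
        ∃ I : (L.sum L').Sentence,
          GroundInterpolation.IsGeneralGroundInterpolant T L' A B I := by
  have hT := hQE.hasStrongAmalgamation hU
  exact ⟨fun ⟨c⟩ _ A B hA hB =>
      mainTheorem12_general hT hA hB (GroundInterpolation.inl_mem_sharedFunctions A B c),
    fun _ _ _ hA hB ⟨_, hc⟩ =>
      mainTheorem12_general hT hA hB (GroundInterpolation.inr_mem_sharedFunctions.2 hc)⟩
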